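/- Let $S^{d-1}=\{x\in\mathbb{R}^d:\langle x,x\rangle=1\}$, and let $\mu$ be the Lebesgue measure on $S^{d-1}$ normalized so that $\mu(S^{d-1})=1$. A non-empty finite set $X\subset S^{d-1}$ is a spherical $t$-design ($t\ge 0$ an integer) if $$\int_{S^{d-1}} f\,d\mu=\frac1{|X|}\sum_{x\in X}f(x)$$ for every real polynomial $f$ in $d$ variables of degree at most $t$. For finite sets $X,Y\subset S^{d-1}$ put $A(X,Y)=\{\langle x,y\rangle : x\in X,\ y\in Y,\ x\ne y\}$. **Theorem.** For $i\in\{1,\dots,n\}$ let $X_i$ be a spherical $t_i$-design in $S^{d-1}$, and suppose that for all $i,j$ either $X_i=X_j$ or $X_i\cap X_j=\emptyset$. Let $s_{i,j}=|A(X_i,X_j)|$. Assume that for each pair $i,j\in\{1,\dots,n\}$ at least one of the following holds: (i) $s_{i,j}-1\le t_j$; (ii) $s_{i,j}-2=t_j$ and $X_i=-X_j$. Then the collection $X_1,\dots,X_n$ is distance-invariant: for all $i,j$ and all $\alpha\in A(X_i,X_j)$, the number $p^j_\alpha(x)=|\{y\in X_j : \langle x,y\rangle=\alpha\}|$ is the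 same for all $x\in X_i$. -/

import Mathlib

open MeasureTheory

/-- The Lebesgue (surface) measure on the unit sphere of `ℝ^d`, normalized to total mass one. -/
noncomputable def sphereMeasure (d : ℕ) :
    Measure (Metric.sphere (0 : EuclideanSpace ℝ (Fin d)) 1) :=
  ((volume : Measure (EuclideanSpace ℝ (Fin d))).toSphere Set.univ)⁻¹ •
    (volume : Measure (EuclideanSpace ℝ (Fin d))).toSphere

/-- A nonempty finite set `X` on the unit sphere of `ℝ^d` is a spherical `t`-design if the average
over `X` of every real polynomial of total degree at most `t` equals its average over the sphere. -/
def IsSphericalDesign {d : ℕ} (t : ℕ) (X : Finset (EuclideanSpace ℝ (Fin d))) : Prop :=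
  X.Nonempty ∧ (X : Set (EuclideanSpace ℝ (Fin d))) ⊆ Metric.sphere 0 1 ∧
    ∀ f : MvPolynomial (Fin d) ℝ, f.totalDegree ≤ t →
      ∫ y : Metric.sphere (0 : EuclideanSpace ℝ (Fin d)) 1,
          MvPolynomial.eval (fun k => (y : EuclideanSpace ℝ (Fin d)) k) f ∂(sphereMeasure d)
        = (1 / (X.card : ℝ)) * ∑ x ∈ X, MvPolynomial.eval (fun k => x k) f

/-- The angle set `A(X, Y)`: all inner products of distinct points `x ∈ X`, `y ∈ Y`. -/
def angleSet {d : ℕ} (X Y : Finset (EuclideanSpace ℝ (Fin d))) : Set ℝ :=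
  {a | ∃ x ∈ X, ∃ y ∈ Y, x ≠ y ∧ inner ℝ x y = a}

/-- A collection `X₁, …, Xₙ` is distance-invariant if for all `i, j` and all `α ∈ A(X_i, X_j)` the
number of `y ∈ X_j` with `⟨x, y⟩ = α` is the same for all `x ∈ X_i`. -/
def IsDistanceInvariant {d n : ℕ} (X : Fin n → Finset (EuclideanSpace ℝ (Fin d))) : Prop :=
  ∀ i j : Fin n, ∀ α ∈ angleSet (X i) (X j), ∃ p : ℕ, ∀ x ∈ X i,
    {y : EuclideanSpace ℝ (Fin d) | y ∈ X j ∧ inner ℝ x y = α}.ncard = p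

/-! Fix `α` and let `g` be the Lagrange basis polynomial at `α` with nodes `A(X_i, X_j)`, of degree
`s_{i,j} - 1`. If this is at most `t_j`, the design property turns the sum of `g ⟪x, y⟫` over `y ∈
X_j` into a zonal integral, independent of `x` by reflection invariance
(`IsSphericalDesign.sum_zonal_eq`). The same sum is `p^j_α(x)`, plus `g(1)` when `x ∈ X_j`, which
holds for all `x ∈ X_i` or for none. In the antipodal case the node `-1` is dropped to save one
degree: `-x` then adds the constant `g(-1)`. -/

open scoped Pointwise in
/-- Linear isometries preserve the measure that Lebesgue measure induces on the sphere. -/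
theorem measurePreserving_sphere_of_linearIsometryEquiv {d : ℕ}
    (e : EuclideanSpace ℝ (Fin d) ≃ₗᵢ[ℝ] EuclideanSpace ℝ (Fin d))
    (φ : Metric.sphere (0 : EuclideanSpace ℝ (Fin d)) 1 ≃ᵐ
      Metric.sphere (0 : EuclideanSpace ℝ (Fin d)) 1)
    (hφ : ∀ y, (φ y : EuclideanSpace ℝ (Fin d)) = e y) :
    MeasurePreserving φ (volume : Measure (EuclideanSpace ℝ (Fin d))).toSphere
      (volume : Measure (EuclideanSpace ℝ (Fin d))).toSphere := by
  refine ⟨φ.measurable, Measure.ext fun s hs => ?_⟩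
  rw [Measure.map_apply φ.measurable hs, Measure.toSphere_apply' _ hs,
    Measure.toSphere_apply' _ (φ.measurable hs)]
  have himage : ((↑) '' s : Set (EuclideanSpace ℝ (Fin d))) = e '' ((↑) '' (φ ⁻¹' s)) := by
    ext v
    simp only [Set.mem_image, exists_exists_and_eq_and, Set.mem_preimage]
    constructor
    · rintro ⟨y, hy, rfl⟩
      exact ⟨φ.symm y, by simpa using hy, by rw [← hφ, φ.apply_symm_apply]⟩
    · rintro ⟨y, hy, rfl⟩
      exact ⟨φ y, hy, hφ y⟩
  -- `toSphere` is a multiple of the volume of the cone over a set, so invariance of Lebesgue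
  -- measure suffices.
  have hcone : Set.Ioo (0 : ℝ) 1 • ((↑) '' s : Set (EuclideanSpace ℝ (Fin d))) =
      e.symm ⁻¹' (Set.Ioo (0 : ℝ) 1 • ((↑) '' (φ ⁻¹' s))) := by
    rw [himage, ← LinearIsometryEquiv.image_eq_preimage_symm]
    ext v
    simp only [Set.mem_smul, Set.mem_image]
    constructor
    · rintro ⟨r, hr, _, ⟨w, hw, rfl⟩, rfl⟩
      exact ⟨r • w, ⟨r, hr, w, hw, rfl⟩, by simp⟩
    · rintro ⟨_, ⟨r, hr, w, hw, rfl⟩, rfl⟩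
      exact ⟨r, hr, e w, ⟨w, hw, rfl⟩, by simp⟩
  have hvol := (LinearIsometryEquiv.measurePreserving e.symm).measure_preimage_emb
    e.symm.toHomeomorph.measurableEmbedding (Set.Ioo (0 : ℝ) 1 • ((↑) '' (φ ⁻¹' s)))
  rw [hcone, hvol]

/-- The integral over the sphere of a zonal function does not depend on its axis. -/
theorem integral_zonal_eq {d : ℕ} (g : ℝ → ℝ) {v w : EuclideanSpace ℝ (Fin d)}
    (h : ‖v‖ = ‖w‖) :
    ∫ y : Metric.sphere (0 : EuclideanSpace ℝ (Fin d)) 1, g (inner ℝ v y) ∂(sphereMeasure d) =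
      ∫ y : Metric.sphere (0 : EuclideanSpace ℝ (Fin d)) 1, g (inner ℝ w y) ∂(sphereMeasure d) := by
  -- For equal norms this reflection carries `v` to `w`; as an involution it is its own inverse.
  let e := (ℝ ∙ (v - w))ᗮ.reflection
  have he : e v = w := Submodule.reflection_sub h
  have hinv (y) : e (e y) = y := Submodule.reflection_reflection _ y
  have hmem (y : Metric.sphere (0 : EuclideanSpace ℝ (Fin d)) 1) :
      e y ∈ Metric.sphere (0 : EuclideanSpace ℝ (Fin d)) 1 := by
    have := y.2
    simp only [mem_sphere_zero_iff_norm] at this ⊢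
    rw [e.norm_map, this]
  have hmeas : Measurable fun y : Metric.sphere (0 : EuclideanSpace ℝ (Fin d)) 1 =>
      (⟨e y, hmem y⟩ : Metric.sphere (0 : EuclideanSpace ℝ (Fin d)) 1) :=
    (e.continuous.measurable.comp measurable_subtype_coe).subtype_mk
  let φ : Metric.sphere (0 : EuclideanSpace ℝ (Fin d)) 1 ≃ᵐ
      Metric.sphere (0 : EuclideanSpace ℝ (Fin d)) 1 :=
    { toFun := fun y => ⟨e y, hmem y⟩
      invFun := fun y => ⟨e y, hmem y⟩
      left_inv := fun y => Subtype.ext (hinv y)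
      right_inv := fun y => Subtype.ext (hinv y)
      measurable_toFun := hmeas
      measurable_invFun := hmeas }
  rw [sphereMeasure, integral_smul_measure, integral_smul_measure,
    ← (measurePreserving_sphere_of_linearIsometryEquiv e φ fun _ => rfl).integral_comp' (g := fun
      y : Metric.sphere (0 : EuclideanSpace ℝ (Fin d)) 1 => g (inner ℝ w y))]
  congr 2
  funext y
  change _ = g (inner ℝ w (e y))
  rw [← he, e.inner_map_map]

/-- The polynomial in the coordinates of `y` whose value is `g ⟪x, y⟫`. -/
noncomputable def zonalPolynomial {d : ℕ} (g : Polynomial ℝ) (x : EuclideanSpace ℝ (Fin d)) :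
    MvPolynomial (Fin d) ℝ :=
  Polynomial.aeval (∑ k, MvPolynomial.C (x k) * MvPolynomial.X k) g

theorem eval_zonalPolynomial {d : ℕ} (g : Polynomial ℝ) (x y : EuclideanSpace ℝ (Fin d)) :
    MvPolynomial.eval (fun k => y k) (zonalPolynomial g x) = g.eval (inner ℝ x y) := by
  rw [zonalPolynomial, ← MvPolynomial.coe_aeval_eq_eval, RingHom.coe_coe,
    ← Polynomial.aeval_algHom_apply, Polynomial.coe_aeval_eq_eval]
  congr 1
  simp [PiLp.inner_apply, mul_comm]

theorem totalDegree_zonalPolynomial_le {d : ℕ} (g : Polynomial ℝ)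
    (x : EuclideanSpace ℝ (Fin d)) : (zonalPolynomial g x).totalDegree ≤ g.natDegree := by
  have hlin : (∑ k, MvPolynomial.C (x k) * MvPolynomial.X k :
      MvPolynomial (Fin d) ℝ).totalDegree ≤ 1 := by
    refine MvPolynomial.totalDegree_finsetSum_le fun k _ => ?_
    refine (MvPolynomial.totalDegree_mul _ _).trans ?_
    simp
  rw [zonalPolynomial, Polynomial.aeval_eq_sum_range]
  refine MvPolynomial.totalDegree_finsetSum_le fun m hm => ?_
  refine (MvPolynomial.totalDegree_smul_le _ _).trans ((MvPolynomial.totalDegree_pow _ _).trans ?_)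
  have : m ≤ g.natDegree := Nat.lt_succ_iff.mp (Finset.mem_range.mp hm)
  nlinarith

/-- The sum of a zonal polynomial of degree at most `t` over a `t`-design does not depend on
its axis. -/
theorem IsSphericalDesign.sum_zonal_eq {d t : ℕ} {Y : Finset (EuclideanSpace ℝ (Fin d))}
    (hY : IsSphericalDesign t Y) {g : Polynomial ℝ} (hg : g.natDegree ≤ t)
    {v w : EuclideanSpace ℝ (Fin d)} (h : ‖v‖ = ‖w‖) :
    ∑ y ∈ Y, g.eval (inner ℝ v y) = ∑ y ∈ Y, g.eval (inner ℝ w y) := by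
  obtain ⟨hne, -, hint⟩ := hY
  have hv := hint (zonalPolynomial g v) ((totalDegree_zonalPolynomial_le g v).trans hg)
  have hw := hint (zonalPolynomial g w) ((totalDegree_zonalPolynomial_le g w).trans hg)
  simp only [eval_zonalPolynomial] at hv hw
  rw [integral_zonal_eq (fun a => g.eval a) h, hw] at hv
  have hc : (1 / (Y.card : ℝ)) ≠ 0 := by
    simpa using hne.ne_empty
  exact (mul_left_cancel₀ hc hv).symm

/-- If a polynomial of degree at most `t` agrees with the indicator of `α` on the inner products
between `X` and a `t`-design `Y`, up to corrections at coinciding and antipodal pairs, then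
the number of points of `Y` at inner product `α` is constant on `X`. -/
theorem IsSphericalDesign.exists_ncard_inner_eq {d t : ℕ}
    {X Y : Finset (EuclideanSpace ℝ (Fin d))} (hY : IsSphericalDesign t Y)
    (hX : ∀ x ∈ X, ‖x‖ = 1) {g : Polynomial ℝ} (hg : g.natDegree ≤ t) {α a b : ℝ}
    (h : ∀ x ∈ X, ∀ y ∈ Y, g.eval (inner ℝ x y) =
      (if inner ℝ x y = α then 1 else 0) + (if y = x then a else 0) + (if y = -x then b else 0))
    (hmem : ∀ x ∈ X, ∀ x' ∈ X, x ∈ Y → x' ∈ Y) (hb : b = 0 ∨ ∀ x ∈ X, -x ∈ Y) :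
    ∃ p : ℕ, ∀ x ∈ X, {y | y ∈ Y ∧ inner ℝ x y = α}.ncard = p := by
  classical
  have hsum : ∀ x ∈ X, ∑ y ∈ Y, g.eval (inner ℝ x y) =
      ({y | y ∈ Y ∧ inner ℝ x y = α}.ncard : ℝ) + (if x ∈ Y then a else 0) + b := by
    intro x hx
    rw [Finset.sum_congr rfl (h x hx), Finset.sum_add_distrib, Finset.sum_add_distrib,
      Finset.sum_ite_eq', Finset.sum_ite_eq', Finset.sum_boole,
      ← Set.ncard_coe_finset, Finset.coe_filter]
    rcases hb with rfl | hb
    · simp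
    · rw [if_pos (hb x hx)]
  rcases X.eq_empty_or_nonempty with rfl | ⟨x₀, hx₀⟩
  · exact ⟨0, by simp⟩
  refine ⟨{y | y ∈ Y ∧ inner ℝ x₀ y = α}.ncard, fun x hx => ?_⟩
  have heq := hY.sum_zonal_eq hg ((hX x hx).trans (hX x₀ hx₀).symm)
  rw [hsum x hx, hsum x₀ hx₀] at heq
  -- The correction `a` occurs for both points or for neither, so it cancels.
  have hiff : x ∈ Y ↔ x₀ ∈ Y := ⟨hmem x hx x₀ hx₀, hmem x₀ hx₀ x hx⟩
  simp only [hiff, add_left_inj] at heq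
  exact_mod_cast heq

theorem angleSet_finite {d : ℕ} (X Y : Finset (EuclideanSpace ℝ (Fin d))) :
    (angleSet X Y).Finite := by
  refine ((X.finite_toSet.image2 (inner ℝ) Y.finite_toSet)).subset ?_
  rintro _ ⟨x, hx, y, hy, -, rfl⟩
  exact ⟨x, hx, y, hy, rfl⟩

theorem Lagrange.natDegree_basis_id_lt {B : Finset ℝ} {α : ℝ} (hα : α ∈ B) :
    (Lagrange.basis B id α).natDegree < B.card := by
  have hpos := Finset.card_pos.mpr ⟨α, hα⟩
  rw [Polynomial.natDegree_eq_of_degree_eq_some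
    (Lagrange.degree_basis (Function.injective_id.injOn) hα)]
  omega

theorem Lagrange.eval_basis_id {B : Finset ℝ} {α β : ℝ} (hα : α ∈ B) (hβ : β ∈ B) :
    (Lagrange.basis B id α).eval β = if β = α then 1 else 0 := by
  split_ifs with h
  · subst h
    exact Lagrange.eval_basis_self (v := id) Function.injective_id.injOn hα
  · exact Lagrange.eval_basis_of_ne (v := id) (Ne.symm h) hβ

theorem mainTheorem8 {d n : ℕ} (t : Fin n → ℕ)
    (X : Fin n → Finset (EuclideanSpace ℝ (Fin d)))
    (hX : ∀ i, IsSphericalDesign (t i) (X i))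
    (hdisj : ∀ i j, X i = X j ∨ Disjoint (X i) (X j))
    (hs : ∀ i j,
      (angleSet (X i) (X j)).ncard ≤ t j + 1 ∨
      ((angleSet (X i) (X j)).ncard = t j + 2 ∧
        ∀ x : EuclideanSpace ℝ (Fin d), x ∈ X i ↔ -x ∈ X j)) :
    IsDistanceInvariant X := by
  classical
  intro i j α hα
  have hnorm (k : Fin n) : ∀ x ∈ X k, ‖x‖ = 1 := fun x hx => by
    simpa using (hX k).2.1 (Finset.mem_coe.mpr hx)
  have hmem : ∀ x ∈ X i, ∀ x' ∈ X i, x ∈ X j → x' ∈ X j := by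
    intro x hx x' hx' hxj
    rcases hdisj i j with h | h
    · exact h ▸ hx'
    · exact absurd hxj (Finset.disjoint_left.mp h hx)
  have hne_neg : ∀ x ∈ X i, x ≠ -x := by
    intro x hx h
    have h2 : (2 : ℝ) • x = 0 := by rw [two_smul, ← eq_neg_iff_add_eq_zero, ← h]
    have h0 : x = 0 := (smul_eq_zero.mp h2).resolve_left two_ne_zero
    simpa [h0] using hnorm i x hx
  have hα1 : α ≠ 1 := by
    obtain ⟨x, hx, y, hy, hxy, rfl⟩ := hα
    exact fun h => hxy ((inner_eq_one_iff_of_norm_eq_one (hnorm i x hx) (hnorm j y hy)).mp h)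
  have hself : ∀ x ∈ X i, inner ℝ x x = (1 : ℝ) := fun x hx => by
    rw [real_inner_self_eq_norm_sq, hnorm i x hx, one_pow]
  have hfin := angleSet_finite (X i) (X j)
  rcases hs i j with hcard | ⟨hcard, hneg⟩
  · set B := hfin.toFinset with hB
    have hαB : α ∈ B := hfin.mem_toFinset.mpr hα
    rw [Set.ncard_eq_toFinset_card _ hfin, ← hB] at hcard
    have hdeg := Lagrange.natDegree_basis_id_lt hαB
    -- The value of the basis polynomial at `1` is arbitrary: `1` is never a node, and only `y = x`
    -- attains it.
    refine (hX j).exists_ncard_inner_eq (hnorm i) (g := Lagrange.basis B id α) (by omega)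
      (a := (Lagrange.basis B id α).eval 1) (b := 0) (fun x hx y hy => ?_) hmem (Or.inl rfl)
    by_cases hyx : y = x
    · subst hyx
      rw [hself y hx]
      simp [hα1.symm]
    · rw [Lagrange.eval_basis_id hαB
        (hfin.mem_toFinset.mpr ⟨x, hx, y, hy, Ne.symm hyx, rfl⟩)]
      simp [hyx]
  · have hmem_neg : ∀ x ∈ X i, -x ∈ X j := fun x hx => (hneg x).mp hx
    have hinner_neg : ∀ x ∈ X i, ∀ y ∈ X j, inner ℝ x y = (-1 : ℝ) ↔ y = -x := by
      intro x hx y hy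
      rw [inner_eq_neg_one_iff_of_norm_eq_one (hnorm i x hx) (hnorm j y hy), eq_neg_iff_add_eq_zero,
        eq_neg_iff_add_eq_zero, add_comm]
    -- Here `-1` will not be a node, so it needs a direct count: only `-x` attains it.
    by_cases hα' : α = -1
    · refine ⟨1, fun x hx => ?_⟩
      rw [Set.ncard_eq_one]
      refine ⟨-x, Set.ext fun y => ?_⟩
      rw [Set.mem_singleton_iff, hα']
      constructor
      · rintro ⟨hy, h⟩
        exact (hinner_neg x hx y hy).mp h
      · rintro rfl
        exact ⟨hmem_neg x hx, (hinner_neg x hx _ (hmem_neg x hx)).mpr rfl⟩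
    -- Removing `-1` leaves `t j + 1` nodes, hence degree at most `t j`.
    · set B := hfin.toFinset.erase (-1) with hB
      have hαB : α ∈ B := Finset.mem_erase.mpr ⟨hα', hfin.mem_toFinset.mpr hα⟩
      have hneg_mem : (-1 : ℝ) ∈ hfin.toFinset := by
        obtain ⟨x, hx, -⟩ := hα
        exact hfin.mem_toFinset.mpr ⟨x, hx, -x, hmem_neg x hx, hne_neg x hx,
          (hinner_neg x hx _ (hmem_neg x hx)).mpr rfl⟩
      have hcardB : B.card = t j + 1 := by
        rw [hB, Finset.card_erase_of_mem hneg_mem, ← Set.ncard_eq_toFinset_card _ hfin, hcard]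
        rfl
      have hdeg := Lagrange.natDegree_basis_id_lt hαB
      refine (hX j).exists_ncard_inner_eq (hnorm i) (g := Lagrange.basis B id α) (by omega)
        (a := (Lagrange.basis B id α).eval 1) (b := (Lagrange.basis B id α).eval (-1))
        (fun x hx y hy => ?_) hmem (Or.inr hmem_neg)
      by_cases hyx : y = x
      · subst hyx
        rw [hself y hx]
        simp [hα1.symm, hne_neg y hx]
      by_cases hynx : y = -x
      · rw [(hinner_neg x hx y hy).mpr hynx]
        simp [Ne.symm hα', hynx, (hne_neg x hx).symm]
      · have hβ : inner ℝ x y ∈ B := Finset.mem_erase.mpr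
          ⟨fun h => hynx ((hinner_neg x hx y hy).mp h),
            hfin.mem_toFinset.mpr ⟨x, hx, y, hy, Ne.symm hyx, rfl⟩⟩
        rw [Lagrange.eval_basis_id hαB hβ]
        simp [hyx, hynx]
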